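/- Let $\gamma\in(0,1)$ and let $\omega\in C^{1,\gamma}([0,1])$. Put $\Omega(p)=\int_0^p\omega(t)\,dt$, let $s_0\ge 0$ be given by $s_0^2=\max_{p\in[0,1]}2\Omega(p)$, and for $s>s_0$ let $$d(s)=\int_0^1\frac{dp}{\sqrt{s^2-2\Omega(p)}},\qquad R(s)=\tfrac12 s^2-\Omega(1)+d(s).$$ Let $R_c=\inf_{s>s_0}R(s)$ and $d_0=d(s_0)=\int_0^1 (s_0^2-2\Omega(p))^{-1/2}\,dp\in(0,\infty]$ (the integrand being $+\infty$ where $2\Omega(p)=s_0^2$). For $d>0$, a stream solution of depth $d$ is a function $U=U(\cdot\,;d)\in C^2([0,d])$ with $U''+\omega(U)=0$ on $(0,d)$, $U(0)=0$, $U(d)=1$ and $U'>0$ on $[0,d]$. Let $R_c<r<d_0$. Let $\eta:\mathbb R\to(0,\infty)$ be of class $C^{2,\gamma}$, let $D_\eta=\{(x,y):0<y<\eta(x)\}$, and let $\psi\in C^{2,\gamma}(\overline{D_\eta})$ (Hölder continuity of the second derivatives is only needed on bounded subsets) satisfy $$\Delta\psi+\omega(\psi)=0\ \text{ in } D_\eta,\qquad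 \tfrac12|\nabla\psi|^2+y=r\ \text{ and }\ \psi=1\ \text{ on } y=\eta(x),\qquad \psi=0\ \text{ on } y=0,$$ and $\psi_y>0$ on $\overline{D_\eta}$. No periodicity is assumed; write $\max\eta=\sup_{\mathbb R}\eta$ and $\min\eta=\inf_{\mathbb R}\eta$, whether or not these are attained. **Proposition.** Stream solutions of depths $\max\eta$ and $\min\eta$ exist, and for any stream solutions $U(\cdot\,;\max\eta)$ and $U(\cdot\,;\min\eta)$ of these depths $$U_y(0;\max\eta)\le\psi_y(x,0)\le U_y(0;\min\eta)\qquad\text{for all }x\in\mathbb R.$$ -/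

import Mathlib

open Set MeasureTheory
open scoped NNReal ENNReal

noncomputable section

namespace WaterWave

/-- `f` is of class `C^{k,γ}` on `K` (for `K` the closure of a regular domain: up to the boundary).
It has continuous derivatives up to order `k` on `K`, one-sided at boundary points, and
the derivative of order `k` is `γ`-Hölder continuous on every bounded part of `K`. No
uniformity at infinity is asked for, so functions with a finite global `C^{k,γ}` norm and
(for periodic domains) periodic functions of class `C^{k,γ}` are all included. -/
def HolderClass {E F : Type*} [NormedAddCommGroup E] [NormedSpace ℝ E]
    [NormedAddCommGroup F] [NormedSpace ℝ F] (k : ℕ) (γ : ℝ≥0) (f : E → F) (K : Set E) : Prop :=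
  ContDiffOn ℝ k f K ∧
    ∀ A ⊆ K, Bornology.IsBounded A → ∃ C : ℝ≥0, HolderOnWith C γ (iteratedFDerivWithin ℝ k f K) A

/-- The closed fluid region `{(x, y) : 0 ≤ y ≤ η x}`, the closure of
`D_η = {(x, y) : 0 < y < η x}`. -/
def closedFluid (η : ℝ → ℝ) : Set (ℝ × ℝ) := {z | 0 ≤ z.2 ∧ z.2 ≤ η z.1}

/-- `ψ_x` on the closed fluid region. -/
def partialX (η : ℝ → ℝ) (ψ : ℝ × ℝ → ℝ) (z : ℝ × ℝ) : ℝ :=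
  fderivWithin ℝ ψ (closedFluid η) z (1, 0)

/-- `ψ_y` on the closed fluid region. -/
def partialY (η : ℝ → ℝ) (ψ : ℝ × ℝ → ℝ) (z : ℝ × ℝ) : ℝ :=
  fderivWithin ℝ ψ (closedFluid η) z (0, 1)

/-- `(ψ, η)` is a steady (not necessarily periodic) unidirectional water wave with vorticity
function `ω` and Bernoulli constant `r`, in units with mass flux and gravity equal to `1`. -/
structure IsWave (ω : ℝ → ℝ) (γ : ℝ≥0) (r : ℝ) (ψ : ℝ × ℝ → ℝ) (η : ℝ → ℝ) : Prop where
  depth_pos : ∀ x, 0 < η x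
  profile_regular : HolderClass 2 γ η univ
  stream_regular : HolderClass 2 γ ψ (closedFluid η)
  /-- `Δψ + ω(ψ) = 0` in the open fluid region. -/
  laplace : ∀ x y, 0 < y → y < η x →
    iteratedDeriv 2 (fun t => ψ (t, y)) x + iteratedDeriv 2 (fun t => ψ (x, t)) y
      + ω (ψ (x, y)) = 0
  /-- Bernoulli's equation on the surface. -/
  bernoulli : ∀ x, (partialX η ψ (x, η x) ^ 2 + partialY η ψ (x, η x) ^ 2) / 2 + η x = r
  top : ∀ x, ψ (x, η x) = 1
  bottom : ∀ x, ψ (x, 0) = 0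
  /-- Absence of stagnation points in the closed fluid region. -/
  unidirectional : ∀ x y, 0 ≤ y → y ≤ η x → 0 < partialY η ψ (x, y)

/-- `U` is the (unidirectional) stream solution of depth `d`: the laminar flow
`ψ(x, y) = U y`, `η = d`. Its Bernoulli constant is `U'(d)² / 2 + d`. -/
structure IsStream (ω : ℝ → ℝ) (d : ℝ) (U : ℝ → ℝ) : Prop where
  depth_pos : 0 < d
  regular : ContDiffOn ℝ 2 U (Icc 0 d)
  ode : ∀ y ∈ Ioo 0 d, iteratedDeriv 2 U y + ω (U y) = 0
  bottom : U 0 = 0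
  top : U d = 1
  unidirectional : ∀ y ∈ Icc 0 d, 0 < derivWithin U (Icc 0 d) y

/-- `Ω(p) = ∫₀ᵖ ω`. -/
def primitive (ω : ℝ → ℝ) (p : ℝ) : ℝ := ∫ t in (0 : ℝ)..p, ω t

/-- `s₀ ≥ 0` with `s₀² = max_{[0,1]} 2Ω` (nonnegative since `Ω(0) = 0`). -/
def sZero (ω : ℝ → ℝ) : ℝ := √(sSup ((fun p => 2 * primitive ω p) '' Icc 0 1))

/-- Depth `d(s)` of the laminar flow with bottom velocity `s > s₀`. -/
def depth (ω : ℝ → ℝ) (s : ℝ) : ℝ := ∫ p in (0 : ℝ)..1, 1 / √(s ^ 2 - 2 * primitive ω p)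

/-- Bernoulli constant `R(s)` of the laminar flow with bottom velocity `s > s₀`. -/
def bernoulliConst (ω : ℝ → ℝ) (s : ℝ) : ℝ := s ^ 2 / 2 - primitive ω 1 + depth ω s

/-- `R_c`, the least Bernoulli constant of laminar flows. -/
def criticalBernoulli (ω : ℝ → ℝ) : ℝ := sInf (bernoulliConst ω '' Ioi (sZero ω))

/-- `d₀ = d(s₀) ∈ (0, ∞]`, the supremum of the depths of laminar flows; the integrand is `∞`
where `2Ω = s₀²`. -/
def maxDepth (ω : ℝ → ℝ) : ℝ≥0∞ :=
  ∫⁻ p in Icc (0 : ℝ) 1, (ENNReal.ofReal √(sZero ω ^ 2 - 2 * primitive ω p))⁻¹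

end WaterWave

end

open Filter Topology

namespace WaterWave

/-! A laminar flow has squared velocity `q = E - 2Ω` on the streamline `p`, so this streamline lies
at height `H(p) = ∫₀ᵖ q^{-1/2}`. If `H(1) = sup η`, then `y - H(ψ)` vanishes on the bottom and is
nonpositive on the surface; a maximum principle makes it nonpositive throughout. Its `y`-derivative
on the bottom, `1 - ψ_y(x,0)/√(q 0)`, is then nonpositive, which is the lower bound; `inf η` gives
the upper bound with the signs reversed. The sign `σ = ±1` treats both cases at once.

Since the domain is unbounded and nothing is periodic, extrema need not be attained.
`IsWave.comparison` therefore subtracts `ε x²` and uses a strict sub- or supersolution, obtained by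
adding `2σδp` to `q`; `IsWave.comparison_laminar` lets `δ → 0`.

Depths below `d₀` are laminar by the intermediate value theorem in `E` (`exists_height_eq`).
Bernoulli's equation gives `η ≤ r < d₀`, and comparison with a very fast flow gives `inf η > 0`
(`IsWave.exists_le_profile`). Finally, energy conservation identifies every stream solution with
such a flow (`IsStream.exists_energy`). -/

/-! ### Calculus at a maximum point. -/

/-- Second-derivative test: at a local maximum the second derivative is nonpositive. -/
lemma deriv_deriv_nonpos_of_isLocalMax {f : ℝ → ℝ} {a c : ℝ} (hf : IsLocalMax f a)
    (hcont : ContinuousAt f a) (h2 : HasDerivAt (deriv f) c a) : c ≤ 0 := by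
  -- A positive second derivative would also make `a` a local minimum, so `f` would be locally
  -- constant and `c = 0`.
  by_contra! hc
  have h1 := hf.deriv_eq_zero
  have hmin : IsLocalMin f a :=
    isLocalMin_of_deriv_deriv_pos (by rwa [h2.deriv]) h1 hcont
  have hconst : f =ᶠ[𝓝 a] fun _ => f a := by
    filter_upwards [hf, hmin] with t h h'
    exact le_antisymm h h'
  have := hconst.deriv.deriv_eq
  rw [h2.deriv] at this
  simp at this
  exact hc.ne' this

lemma hasDerivAt_deriv_of_contDiffAt {f : ℝ → ℝ} {x : ℝ} (hf : ContDiffAt ℝ 2 f x) :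
    (∀ᶠ t in 𝓝 x, HasDerivAt f (deriv f t) t) ∧
      HasDerivAt (deriv f) (iteratedDeriv 2 f x) x := by
  constructor
  · filter_upwards [hf.eventually (by simp)] with t ht
    exact (ht.differentiableAt (by simp)).hasDerivAt
  · have h2 : iteratedDeriv 2 f x = deriv (deriv f) x := by
      rw [iteratedDeriv_succ, iteratedDeriv_one]
    rw [h2]
    apply DifferentiableAt.hasDerivAt
    have h1 : ContDiffAt ℝ 1 (fderiv ℝ f) x := hf.fderiv_right (by norm_num)
    exact (h1.differentiableAt (by simp)).clm_apply (differentiableAt_const (1 : ℝ))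

/-- First and second order conditions at a local maximum of `k - H ∘ u`. -/
lemma localMax_sub_comp {H g u k : ℝ → ℝ} {x g' : ℝ}
    (hH : ∀ p, HasDerivAt H (g p) p) (hg : HasDerivAt g g' (u x))
    (hu : ContDiffAt ℝ 2 u x) (hk : ContDiffAt ℝ 2 k x)
    (hmax : IsLocalMax (fun t => k t - H (u t)) x) :
    deriv k x = g (u x) * deriv u x ∧
      iteratedDeriv 2 k x ≤ g' * deriv u x ^ 2 + g (u x) * iteratedDeriv 2 u x := by
  obtain ⟨u1, u2⟩ := hasDerivAt_deriv_of_contDiffAt hu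
  obtain ⟨k1, k2⟩ := hasDerivAt_deriv_of_contDiffAt hk
  have hd : ∀ᶠ t in 𝓝 x,
      HasDerivAt (fun t => k t - H (u t)) (deriv k t - g (u t) * deriv u t) t := by
    filter_upwards [u1, k1] with t h h'
    exact h'.sub ((hH (u t)).comp t h)
  have hd' : deriv (fun t => k t - H (u t)) =ᶠ[𝓝 x]
      fun t => deriv k t - g (u t) * deriv u t := by
    filter_upwards [hd] with t h using h.deriv
  have hgu : HasDerivAt (fun t => g (u t)) (g' * deriv u x) x :=
    hg.comp x u1.self_of_nhds
  have h2 := (k2.sub (hgu.mul u2)).congr_of_eventuallyEq hd'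
  have h0 := hmax.hasDerivAt_eq_zero hd.self_of_nhds
  have h3 := deriv_deriv_nonpos_of_isLocalMax hmax hd.self_of_nhds.continuousAt h2
  constructor
  · linarith
  · nlinarith [h3]

/-- At a maximum over `[a, b]` attained at the right endpoint the one-sided derivative
is nonnegative. -/
lemma nonneg_of_isMaxOn_right {f : ℝ → ℝ} {a b c : ℝ} (hab : a < b)
    (hf : HasDerivWithinAt f c (Icc a b) b) (hmax : ∀ t ∈ Icc a b, f t ≤ f b) : 0 ≤ c := by
  have h := (hf.mono (Ioo_subset_Icc_self (a := a) (b := b)))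
  rw [hasDerivWithinAt_iff_tendsto_slope' (by simp)] at h
  have : (𝓝[Ioo a b] b).NeBot := by
    rw [nhdsWithin_Ioo_eq_nhdsLT hab]; infer_instance
  refine ge_of_tendsto h ?_
  filter_upwards [self_mem_nhdsWithin] with t ht
  rw [slope_def_field]
  exact div_nonneg_of_nonpos (by linarith [hmax t ⟨ht.1.le, ht.2.le⟩]) (by linarith [ht.2])

/-! ### Elementary properties of waves and the maximum principle. -/

section Wave

variable {ω : ℝ → ℝ} {γ : ℝ≥0} {r : ℝ} {ψ : ℝ × ℝ → ℝ} {η : ℝ → ℝ}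

lemma IsWave.continuous_profile (h : IsWave ω γ r ψ η) : Continuous η :=
  (contDiffOn_univ.1 h.profile_regular.1).continuous

lemma IsWave.profile_le (h : IsWave ω γ r ψ η) (x : ℝ) : η x ≤ r := by
  have := h.bernoulli x
  nlinarith [sq_nonneg (partialX η ψ (x, η x)), sq_nonneg (partialY η ψ (x, η x))]

lemma IsWave.bddAbove_profile (h : IsWave ω γ r ψ η) : BddAbove (range η) :=
  ⟨r, by rintro _ ⟨x, rfl⟩; exact h.profile_le x⟩

lemma IsWave.bddBelow_profile (h : IsWave ω γ r ψ η) : BddBelow (range η) :=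
  ⟨0, by rintro _ ⟨x, rfl⟩; exact (h.depth_pos x).le⟩

lemma IsWave.hasDerivWithinAt_vertical (h : IsWave ω γ r ψ η) {x y : ℝ}
    (hy : y ∈ Icc 0 (η x)) :
    HasDerivWithinAt (fun t => ψ (x, t)) (partialY η ψ (x, y)) (Icc 0 (η x)) y := by
  have hd : HasFDerivWithinAt ψ (fderivWithin ℝ ψ (closedFluid η) (x, y)) (closedFluid η) (x, y) :=
    ((h.stream_regular.1.differentiableOn (by simp)) (x, y) hy).hasFDerivWithinAt
  have hl : HasDerivWithinAt (fun t : ℝ => (x, t)) ((0 : ℝ), (1 : ℝ)) (Icc 0 (η x)) y :=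
    (hasDerivWithinAt_const y _ x).prodMk (hasDerivWithinAt_id y _)
  exact HasFDerivWithinAt.comp_hasDerivWithinAt y hd hl (fun t ht => ht)

lemma IsWave.strictMonoOn_vertical (h : IsWave ω γ r ψ η) (x : ℝ) :
    StrictMonoOn (fun t => ψ (x, t)) (Icc 0 (η x)) := by
  apply strictMonoOn_of_deriv_pos (convex_Icc _ _)
  · exact fun y hy => (h.hasDerivWithinAt_vertical hy).continuousWithinAt
  · intro y hy
    rw [interior_Icc] at hy
    rw [((h.hasDerivWithinAt_vertical (Ioo_subset_Icc_self hy)).hasDerivAt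
      (Icc_mem_nhds hy.1 hy.2)).deriv]
    exact h.unidirectional x y hy.1.le hy.2.le

lemma IsWave.mem_Icc (h : IsWave ω γ r ψ η) {z : ℝ × ℝ} (hz : z ∈ closedFluid η) :
    ψ z ∈ Icc 0 1 := by
  have hm := (h.strictMonoOn_vertical z.1).monotoneOn
  have hz' : z.2 ∈ Icc 0 (η z.1) := hz
  have h0 := hm (left_mem_Icc.2 (h.depth_pos z.1).le) hz' hz'.1
  have h1 := hm hz' (right_mem_Icc.2 (h.depth_pos z.1).le) hz'.2
  simp only [h.bottom, h.top] at h0 h1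
  exact ⟨h0, h1⟩

lemma IsWave.mem_Ioo (h : IsWave ω γ r ψ η) {x y : ℝ} (hy : y ∈ Ioo 0 (η x)) :
    ψ (x, y) ∈ Ioo 0 1 := by
  have hm := h.strictMonoOn_vertical x
  have h0 := hm (left_mem_Icc.2 (h.depth_pos x).le) (Ioo_subset_Icc_self hy) hy.1
  have h1 := hm (Ioo_subset_Icc_self hy) (right_mem_Icc.2 (h.depth_pos x).le) hy.2
  simp only [h.bottom, h.top] at h0 h1
  exact ⟨h0, h1⟩

lemma IsWave.contDiffAt (h : IsWave ω γ r ψ η) {x y : ℝ} (hy : y ∈ Ioo 0 (η x)) :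
    ContDiffAt ℝ 2 ψ (x, y) := by
  have hc := h.continuous_profile
  have hopen : IsOpen {z : ℝ × ℝ | 0 < z.2 ∧ z.2 < η z.1} :=
    (isOpen_lt continuous_const continuous_snd).inter
      (isOpen_lt continuous_snd (hc.comp continuous_fst))
  have h1 := h.stream_regular.1 (x, y) ⟨hy.1.le, hy.2.le⟩
  refine (h1.contDiffAt ?_)
  exact mem_of_superset (hopen.mem_nhds hy) (fun z hz => ⟨hz.1.le, hz.2.le⟩)

lemma isCompact_fluid_truncated (hη : Continuous η) (r L : ℝ) :
    IsCompact (closedFluid η ∩ (Icc (-L) L ×ˢ Icc 0 r)) := by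
  have hcl : IsClosed (closedFluid η) :=
    (isClosed_le continuous_const continuous_snd).inter
      (isClosed_le continuous_snd (hη.comp continuous_fst))
  exact (isCompact_Icc.prod isCompact_Icc).inter_left hcl

/-- Comparison principle for `σ (y - H ψ)`, where `H` is a strict super- or subsolution of the
equation for the height of the laminar flow. -/
theorem IsWave.comparison (h : IsWave ω γ r ψ η) {σ δ m M B : ℝ} {H g : ℝ → ℝ}
    (hσ : σ = 1 ∨ σ = -1) (hδ : 0 < δ) (hm : 0 < m)
    (hH : ∀ p, HasDerivAt H (g p) p)
    (hg : ∀ p ∈ Ioo (0 : ℝ) 1, HasDerivAt g ((ω p - σ * δ) * g p ^ 3) p)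
    (hgm : ∀ p ∈ Ioo (0 : ℝ) 1, m ≤ g p)
    (hM : ∀ p ∈ Ioo (0 : ℝ) 1, |ω p - σ * δ| ≤ M)
    (hH0 : H 0 = 0) (hB : 0 ≤ B)
    (htop : ∀ x, σ * (η x - H 1) ≤ B ∨ σ * (1 - g 1 * partialY η ψ (x, η x)) < 0) :
    ∀ z ∈ closedFluid η, σ * (z.2 - H (ψ z)) ≤ B := by
  intro z₀ hz₀
  by_contra! hlt
  have hσ2 : σ * σ = 1 := by rcases hσ with rfl | rfl <;> norm_num
  have hHc : Continuous H := continuous_iff_continuousAt.2 fun p => (hH p).continuousAt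
  have hM0 : 0 ≤ M := (abs_nonneg _).trans (hM (1 / 2) (by norm_num))
  have hcont : ContinuousOn (fun z : ℝ × ℝ => σ * (z.2 - H (ψ z))) (closedFluid η) :=
    continuousOn_const.mul (continuousOn_snd.sub
      (hHc.comp_continuousOn h.stream_regular.1.continuousOn))
  -- A global bound exists despite the unbounded domain: `0 ≤ y ≤ r` and `ψ` takes values in
  -- `[0,1]`, where `H` is bounded.
  obtain ⟨K, hK0, hK⟩ : ∃ K, 0 < K ∧ ∀ z ∈ closedFluid η, σ * (z.2 - H (ψ z)) ≤ K := by
    obtain ⟨C, hC⟩ := (isCompact_Icc (a := (0 : ℝ)) (b := 1)).exists_bound_of_continuousOn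
      hHc.continuousOn
    refine ⟨r + C + 1, ?_, fun z hz => ?_⟩
    · have := (h.depth_pos 0).trans_le (h.profile_le 0)
      have := (norm_nonneg _).trans (hC 0 (by simp))
      linarith
    · have h1 := hC _ (h.mem_Icc hz)
      have h2 := hz.2.trans (h.profile_le z.1)
      have h3 := hz.1
      rw [Real.norm_eq_abs, abs_le] at h1
      rcases hσ with rfl | rfl <;> linarith
  -- The penalty must keep the value at `z₀` above `B` and be too weak to offset the strictness `mδ`
  -- in the final inequality.
  obtain ⟨ε, hε, hε1, hε2⟩ : ∃ ε > 0, B < σ * (z₀.2 - H (ψ z₀)) - ε * z₀.1 ^ 2 ∧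
      2 * ε + m * (M * (4 * ε * K)) < m * δ := by
    have t1 : ∀ᶠ ε in 𝓝 (0 : ℝ), B < σ * (z₀.2 - H (ψ z₀)) - ε * z₀.1 ^ 2 := by
      have : ContinuousAt (fun ε : ℝ => σ * (z₀.2 - H (ψ z₀)) - ε * z₀.1 ^ 2) 0 := by fun_prop
      exact this.eventually (lt_mem_nhds (by simpa using hlt))
    have t2 : ∀ᶠ ε in 𝓝 (0 : ℝ), 2 * ε + m * (M * (4 * ε * K)) < m * δ := by
      have : ContinuousAt (fun ε : ℝ => 2 * ε + m * (M * (4 * ε * K))) 0 := by fun_prop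
      exact this.eventually (gt_mem_nhds (by simpa using mul_pos hm hδ))
    have t3 : ∀ᶠ ε in 𝓝[>] (0 : ℝ), 0 < ε := self_mem_nhdsWithin
    obtain ⟨ε, ⟨a, b⟩, c⟩ := (((t1.and t2).filter_mono nhdsWithin_le_nhds).and t3).exists
    exact ⟨ε, c, a, b⟩
  set W : ℝ × ℝ → ℝ := fun z => σ * (z.2 - H (ψ z)) - ε * z.1 ^ 2 with hW
  -- For `|x| ≥ L` the penalty exceeds `K`, so a maximum over the truncated region cannot lie on its
  -- lateral sides.
  obtain ⟨L, hL1, hL2⟩ : ∃ L, |z₀.1| < L ∧ K < ε * L ^ 2 := by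
    have hKε : 0 < K / ε := div_pos hK0 hε
    refine ⟨|z₀.1| + K / ε + 1, by linarith, ?_⟩
    have h1 : K / ε < (|z₀.1| + K / ε + 1) ^ 2 := by nlinarith [abs_nonneg z₀.1]
    rwa [div_lt_iff₀' hε] at h1
  have hL0 : 0 < L := (abs_nonneg _).trans_lt hL1
  obtain ⟨⟨x, y⟩, ⟨hz, hzL⟩, hmax⟩ :=
    (isCompact_fluid_truncated h.continuous_profile r L).exists_isMaxOn
      (f := W) ⟨z₀, hz₀, ⟨(abs_lt.1 hL1).1.le, (abs_lt.1 hL1).2.le⟩,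
        hz₀.1, hz₀.2.trans (h.profile_le _)⟩
      ((hcont.sub (by fun_prop)).mono inter_subset_left)
  have hWB : B < W (x, y) := hε1.trans_le
    (hmax ⟨hz₀, ⟨(abs_lt.1 hL1).1.le, (abs_lt.1 hL1).2.le⟩,
        hz₀.1, hz₀.2.trans (h.profile_le _)⟩)
  have hxK : ε * x ^ 2 < K := by
    have := hK _ hz
    simp only [hW] at hWB
    linarith
  have hxL : |x| < L := by
    apply abs_lt_of_sq_lt_sq _ hL0.le
    by_contra! hcon
    nlinarith [mul_le_mul_of_nonneg_left hcon hε.le]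
  have hmax' : ∀ z ∈ closedFluid η, |z.1| < L → W z ≤ W (x, y) := fun z hz hzL' =>
    hmax ⟨hz, ⟨(abs_lt.1 hzL').1.le, (abs_lt.1 hzL').2.le⟩, hz.1, hz.2.trans (h.profile_le _)⟩
  have hy : y ∈ Icc 0 (η x) := hz
  have hεx : 0 ≤ ε * x ^ 2 := by positivity
  rcases hy.1.eq_or_lt with hy0 | hy0
  · have : W (x, y) = -(ε * x ^ 2) := by simp [hW, ← hy0, h.bottom, hH0]
    linarith
  rcases hy.2.eq_or_lt with hy1 | hy1
  · rcases htop x with ht | ht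
    · have : W (x, y) = σ * (η x - H 1) - ε * x ^ 2 := by simp [hW, hy1, h.top]
      linarith
    -- A negative one-sided vertical derivative rules out a maximum on the surface.
    · have hd : HasDerivWithinAt (fun t => W (x, t))
          (σ * (1 - g 1 * partialY η ψ (x, η x))) (Icc 0 (η x)) (η x) := by
        have h1 := h.hasDerivWithinAt_vertical (right_mem_Icc.2 (h.depth_pos x).le)
        have h2 := (hH (ψ (x, η x))).comp_hasDerivWithinAt (η x) h1
        rw [h.top] at h2
        exact (((hasDerivWithinAt_id _ _).sub h2).const_mul σ).sub_const (ε * x ^ 2)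
      have := nonneg_of_isMaxOn_right (h.depth_pos x) hd fun t ht => by
        have := hmax' (x, t) ht hxL
        rwa [hy1] at this
      linarith
  · have hp := h.mem_Ioo (x := x) (y := y) ⟨hy0, hy1⟩
    have hloc : IsLocalMax W (x, y) := by
      have hopen : IsOpen {z : ℝ × ℝ | (0 < z.2 ∧ z.2 < η z.1) ∧ |z.1| < L} :=
        ((isOpen_lt continuous_const continuous_snd).inter
          (isOpen_lt continuous_snd (h.continuous_profile.comp continuous_fst))).inter
          (isOpen_lt continuous_fst.abs continuous_const)
      filter_upwards [hopen.mem_nhds ⟨⟨hy0, hy1⟩, hxL⟩] with z hz'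
      exact hmax' z ⟨hz'.1.1.le, hz'.1.2.le⟩ hz'.2
    have hψ := h.contDiffAt (x := x) (y := y) ⟨hy0, hy1⟩
    have hHσ : ∀ p, HasDerivAt (fun p => σ * H p) (σ * g p) p := fun p => (hH p).const_mul σ
    have hgσ := (hg _ hp).const_mul σ
    have hX := localMax_sub_comp (H := fun p => σ * H p) (g := fun p => σ * g p)
      (u := fun t => ψ (t, y)) (k := fun t => σ * y - ε * t ^ 2) (x := x) hHσ hgσ
      (hψ.comp x (by fun_prop)) (by fun_prop) (by
        have : ContinuousAt (fun t : ℝ => (t, y)) x := by fun_prop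
        filter_upwards [this.eventually hloc] with t ht
        simp only [hW] at ht ⊢
        linarith)
    have hY := localMax_sub_comp (H := fun p => σ * H p) (g := fun p => σ * g p)
      (u := fun t => ψ (x, t)) (k := fun t => σ * t - ε * x ^ 2) (x := y) hHσ hgσ
      (hψ.comp y (by fun_prop)) (by fun_prop) (by
        have : ContinuousAt (fun t : ℝ => (x, t)) y := by fun_prop
        filter_upwards [this.eventually hloc] with t ht
        simp only [hW] at ht ⊢
        linarith)
    have k1 : deriv (fun t : ℝ => σ * y - ε * t ^ 2) x = -(ε * (2 * x)) := by
      simp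
    have k2 : deriv (fun t : ℝ => σ * t - ε * x ^ 2) y = σ := by
      simp
    have k3 : iteratedDeriv 2 (fun t : ℝ => σ * y - ε * t ^ 2) x = -(ε * 2) := by
      rw [iteratedDeriv_succ, iteratedDeriv_one]
      have : deriv (fun t : ℝ => σ * y - ε * t ^ 2) = fun t => -(ε * (2 * t)) := by
        ext t; simp
      rw [this]; simp
    have k4 : iteratedDeriv 2 (fun t : ℝ => σ * t - ε * x ^ 2) y = 0 := by
      rw [iteratedDeriv_succ, iteratedDeriv_one]
      have : deriv (fun t : ℝ => σ * t - ε * x ^ 2) = fun t => σ := by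
        ext t; simp
      rw [this]; simp
    rw [k1, k3] at hX
    rw [k2, k4] at hY
    have hlap := h.laplace x y hy0 hy1
    have hM' := hM _ hp
    have hm' := hgm _ hp
    obtain ⟨X1, X2⟩ := hX
    obtain ⟨Y1, Y2⟩ := hY
    generalize deriv (fun t => ψ (t, y)) x = a at *
    generalize deriv (fun t => ψ (x, t)) y = b at *
    generalize iteratedDeriv 2 (fun t => ψ (t, y)) x = a2 at *
    generalize iteratedDeriv 2 (fun t => ψ (x, t)) y = b2 at *
    generalize ω (ψ (x, y)) = w at *
    generalize g (ψ (x, y)) = G at *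
    -- With `a = ψ_x`, `b = ψ_y`, the first-order conditions are `G b = 1` and `σ G a = -2εx`; as `ε
    -- x² < K`, the latter makes `(G a)²` of order `ε`.
    have Y1' : G * b = 1 := by
      have := congrArg (σ * ·) Y1
      simp only [← mul_assoc, hσ2, one_mul] at this
      exact this.symm
    have X1' : (G * a) ^ 2 = 4 * ε * (ε * x ^ 2) := by
      have : (G * a) ^ 2 = (σ * σ) * (G * a) ^ 2 := by rw [hσ2, one_mul]
      rw [this]
      calc σ * σ * (G * a) ^ 2 = (σ * G * a) ^ 2 := by ring
        _ = _ := by rw [← X1]; ring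
    -- Adding the second-order conditions and using `Δψ = -w` cancels the terms in `w`, apart from
    -- one multiplied by `(G a)²`; the strict term `-δG` remains.
    have hsum : G * (δ - σ * (w - σ * δ) * (G * a) ^ 2) ≤ 2 * ε := by
      have e1 : -(ε * 2) ≤ σ * G * (a2 + b2) + σ * (w - σ * δ) * G * ((G * a) ^ 2 + (G * b) ^ 2) := by
        linarith [X2, Y2]
      have e2 : a2 + b2 = -w := by linarith
      rw [Y1', e2] at e1
      have e3 : σ * (w - σ * δ) = σ * w - δ := by linear_combination (-δ) * hσ2
      rw [e3] at e1 ⊢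
      linarith
    have hlow : δ - M * (4 * ε * K) ≤ δ - σ * (w - σ * δ) * (G * a) ^ 2 := by
      have f1 : σ * (w - σ * δ) ≤ M := by
        rcases hσ with rfl | rfl <;> linarith [(abs_le.1 hM').1, (abs_le.1 hM').2]
      have f2 : (G * a) ^ 2 ≤ 4 * ε * K := by
        rw [X1']; gcongr
      have f3 := mul_le_mul_of_nonneg_right f1 (sq_nonneg (G * a))
      have f4 := mul_le_mul_of_nonneg_left f2 hM0
      linarith
    have hpos : 0 < δ - M * (4 * ε * K) := by
      by_contra! hc
      nlinarith
    have := mul_le_mul hm' hlow hpos.le (hm.le.trans hm')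
    linarith

end Wave

/-! ### Heights of laminar flows. -/

/-- Nearest-point projection of `ℝ` onto `[0, 1]`. -/
noncomputable def clamp (t : ℝ) : ℝ := max 0 (min 1 t)

lemma continuous_clamp : Continuous clamp := by unfold clamp; fun_prop

lemma clamp_mem (t : ℝ) : clamp t ∈ Icc (0 : ℝ) 1 :=
  ⟨le_max_left _ _, max_le zero_le_one (min_le_left _ _)⟩

lemma clamp_of_mem {t : ℝ} (ht : t ∈ Icc (0 : ℝ) 1) : clamp t = t := by
  rw [clamp, min_eq_right ht.2, max_eq_right ht.1]

/-- Height of the streamline `p` in the laminar flow whose squared velocity on that streamline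
is `q p`, extended with constant velocity outside `[0, 1]`. -/
noncomputable def height (q : ℝ → ℝ) (p : ℝ) : ℝ := ∫ t in (0 : ℝ)..p, 1 / √(q (clamp t))

section Height

variable {q q₁ q₂ : ℝ → ℝ}

lemma height_zero (q : ℝ → ℝ) : height q 0 = 0 := by simp [height]

lemma continuous_invSqrt_clamp (hq : ContinuousOn q (Icc 0 1)) (hpos : ∀ p ∈ Icc (0 : ℝ) 1, 0 < q p) :
    Continuous fun t => 1 / √(q (clamp t)) := by
  have h1 : Continuous fun t => q (clamp t) := hq.comp_continuous continuous_clamp clamp_mem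
  exact continuous_const.div h1.sqrt fun t => (Real.sqrt_pos.2 (hpos _ (clamp_mem t))).ne'

lemma hasDerivAt_height (hq : ContinuousOn q (Icc 0 1)) (hpos : ∀ p ∈ Icc (0 : ℝ) 1, 0 < q p)
    (p : ℝ) : HasDerivAt (height q) (1 / √(q (clamp p))) p :=
  (continuous_invSqrt_clamp hq hpos).integral_hasStrictDerivAt 0 p |>.hasDerivAt

lemma hasDerivAt_invSqrt_clamp {p q' : ℝ} (hp : p ∈ Ioo (0 : ℝ) 1) (hq : HasDerivAt q q' p)
    (hpos : 0 < q p) :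
    HasDerivAt (fun t => 1 / √(q (clamp t))) (-(q' / 2) * (1 / √(q (clamp p))) ^ 3) p := by
  have hs := Real.sqrt_pos.2 hpos
  have h1 := (hq.sqrt hpos.ne').inv hs.ne'
  rw [clamp_of_mem (Ioo_subset_Icc_self hp)]
  have h2 := h1.congr_of_eventuallyEq (f₁ := fun t => 1 / √(q (clamp t))) (by
    filter_upwards [Icc_mem_nhds hp.1 hp.2] with t ht
    rw [clamp_of_mem ht, one_div]; rfl)
  have h3 : -(q' / 2) * (1 / √(q p)) ^ 3 = -(q' / (2 * √(q p))) / √(q p) ^ 2 := by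
    field_simp
  rwa [h3]

lemma strictMono_height (hq : ContinuousOn q (Icc 0 1)) (hpos : ∀ p ∈ Icc (0 : ℝ) 1, 0 < q p) :
    StrictMono (height q) := by
  apply strictMono_of_deriv_pos
  intro p
  rw [(hasDerivAt_height hq hpos p).deriv]
  have := Real.sqrt_pos.2 (hpos _ (clamp_mem p))
  positivity

lemma abs_inv_sqrt_sub_le {a b m : ℝ} (hm : 0 < m) (ha : m ≤ a) (hb : m ≤ b) :
    |1 / √a - 1 / √b| ≤ |a - b| / (m * √m) := by
  have hm' := Real.sqrt_pos.2 hm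
  have ha' : √m ≤ √a := Real.sqrt_le_sqrt ha
  have hb' : √m ≤ √b := Real.sqrt_le_sqrt hb
  have ha0 := hm'.trans_le ha'
  have hb0 := hm'.trans_le hb'
  have hab : a - b = (√a - √b) * (√a + √b) := by
    linear_combination -(Real.sq_sqrt (hm.le.trans ha)) + Real.sq_sqrt (hm.le.trans hb)
  have h1 : 1 / √a - 1 / √b = (b - a) / (√a * √b * (√a + √b)) := by
    rw [← neg_sub a b, hab]
    field_simp
    ring
  rw [h1, abs_div, abs_sub_comm, abs_of_pos (a := √a * √b * (√a + √b)) (by positivity)]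
  have h2 : m * √m = √m * √m * √m := by rw [Real.mul_self_sqrt hm.le]
  rw [h2]
  gcongr
  linarith

/-- Serves both the limit `δ → 0` in the comparison and the continuity of the depth in `E`. -/
lemma abs_height_sub_le {m e : ℝ} (hm : 0 < m) (h₁ : ContinuousOn q₁ (Icc 0 1))
    (h₂ : ContinuousOn q₂ (Icc 0 1)) (hm₁ : ∀ p ∈ Icc (0 : ℝ) 1, m ≤ q₁ p)
    (hm₂ : ∀ p ∈ Icc (0 : ℝ) 1, m ≤ q₂ p) (he : ∀ p ∈ Icc (0 : ℝ) 1, |q₁ p - q₂ p| ≤ e)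
    {p : ℝ} (hp : p ∈ Icc (0 : ℝ) 1) :
    |height q₁ p - height q₂ p| ≤ e / (m * √m) := by
  have he0 : 0 ≤ e := (abs_nonneg _).trans (he 0 (by simp))
  have hm' := Real.sqrt_pos.2 hm
  have i₁ := (continuous_invSqrt_clamp h₁ fun p hp => hm.trans_le (hm₁ p hp)).intervalIntegrable
    (μ := volume) 0 p
  have i₂ := (continuous_invSqrt_clamp h₂ fun p hp => hm.trans_le (hm₂ p hp)).intervalIntegrable
    (μ := volume) 0 p
  rw [height, height, ← intervalIntegral.integral_sub i₁ i₂, ← Real.norm_eq_abs]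
  refine (intervalIntegral.norm_integral_le_of_norm_le_const (C := e / (m * √m)) ?_).trans ?_
  · intro t _
    refine (abs_inv_sqrt_sub_le hm (hm₁ _ (clamp_mem t)) (hm₂ _ (clamp_mem t))).trans ?_
    gcongr
    exact he _ (clamp_mem t)
  · rw [sub_zero, abs_of_nonneg hp.1]
    exact mul_le_of_le_one_right (by positivity) hp.2

end Height

/-! ### The primitive `Ω` on `[0,1]`. -/

section Primitive

variable {ω : ℝ → ℝ}

/-- Since `ω` is controlled only on `[0,1]`, it is replaced by its continuous extension `ω ∘ clamp`,
which has the same primitive there. -/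
lemma hasDerivWithinAt_primitive (hω : ContinuousOn ω (Icc 0 1)) {p : ℝ}
    (hp : p ∈ Icc (0 : ℝ) 1) : HasDerivWithinAt (primitive ω) (ω p) (Icc 0 1) p := by
  have hc : Continuous fun t => ω (clamp t) := hω.comp_continuous continuous_clamp clamp_mem
  have h1 := (hc.integral_hasStrictDerivAt 0 p).hasDerivAt.hasDerivWithinAt (s := Icc 0 1)
  rw [clamp_of_mem hp] at h1
  have he : ∀ x ∈ Icc (0 : ℝ) 1, primitive ω x = ∫ t in (0 : ℝ)..x, ω (clamp t) := by
    intro x hx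
    apply intervalIntegral.integral_congr
    intro t ht
    rw [uIcc_of_le hx.1] at ht
    simp only [clamp_of_mem ⟨ht.1, ht.2.trans hx.2⟩]
  exact h1.congr he (he p hp)

lemma continuousOn_primitive (hω : ContinuousOn ω (Icc 0 1)) :
    ContinuousOn (primitive ω) (Icc 0 1) :=
  fun _ hp => (hasDerivWithinAt_primitive hω hp).continuousWithinAt

lemma hasDerivAt_primitive (hω : ContinuousOn ω (Icc 0 1)) {p : ℝ} (hp : p ∈ Ioo (0 : ℝ) 1) :
    HasDerivAt (primitive ω) (ω p) p :=
  (hasDerivWithinAt_primitive hω (Ioo_subset_Icc_self hp)).hasDerivAt (Icc_mem_nhds hp.1 hp.2)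

lemma primitive_zero (ω : ℝ → ℝ) : primitive ω 0 = 0 := by simp [primitive]

end Primitive

/-! ### Comparison of waves with laminar profiles. -/

section Wave

variable {ω : ℝ → ℝ} {γ : ℝ≥0} {r : ℝ} {ψ : ℝ × ℝ → ℝ} {η : ℝ → ℝ}

/-- Comparison of a wave with the perturbed laminar profile with squared velocity
`E - 2 Ω(p) + 2 σ δ p`. -/
theorem IsWave.comparison_height (h : IsWave ω γ r ψ η) (hω : ContinuousOn ω (Icc 0 1))
    {σ δ E B : ℝ} {q : ℝ → ℝ} (hσ : σ = 1 ∨ σ = -1) (hδ : 0 < δ)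
    (hq : q = fun p => E - 2 * primitive ω p + 2 * (σ * δ) * p)
    (hpos : ∀ p ∈ Icc (0 : ℝ) 1, 0 < q p) (hB : 0 ≤ B)
    (htop : ∀ x, σ * (η x - height q 1) ≤ B ∨
      σ * (1 - 1 / √(q 1) * partialY η ψ (x, η x)) < 0) :
    ∀ z ∈ closedFluid η, σ * (z.2 - height q (ψ z)) ≤ B := by
  have hqc : ContinuousOn q (Icc 0 1) := by
    rw [hq]
    have := continuousOn_primitive hω
    fun_prop
  obtain ⟨Q, hQ⟩ := isCompact_Icc.exists_bound_of_continuousOn hqc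
  obtain ⟨M, hM⟩ := isCompact_Icc.exists_bound_of_continuousOn
    (hω.sub (continuousOn_const (c := σ * δ)))
  have hQ0 : 0 < Q := (hpos 0 (by simp)).trans_le ((le_abs_self _).trans (hQ 0 (by simp)))
  refine h.comparison (m := 1 / √Q) (M := M) (g := fun p => 1 / √(q (clamp p))) hσ hδ
    (by positivity) (hasDerivAt_height hqc hpos) ?_ ?_ ?_ (height_zero q) hB ?_
  · intro p hp
    have hd : HasDerivAt q (-(2 * ω p) + 2 * (σ * δ)) p := by
      rw [hq]
      have h1 := (((hasDerivAt_primitive hω hp).const_mul 2).const_sub E).add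
        ((hasDerivAt_id p).const_mul (2 * (σ * δ)))
      rw [mul_one] at h1
      exact h1
    have := hasDerivAt_invSqrt_clamp hp hd (hpos p (Ioo_subset_Icc_self hp))
    convert this using 1
    ring
  · intro p hp
    have hp' := Ioo_subset_Icc_self hp
    simp only [clamp_of_mem hp']
    have := Real.sqrt_pos.2 (hpos p hp')
    exact one_div_le_one_div_of_le this
      (Real.sqrt_le_sqrt ((le_abs_self _).trans (hQ p hp')))
  · exact fun p hp => hM p (Ioo_subset_Icc_self hp)
  · intro x
    simpa only [clamp_of_mem (right_mem_Icc.2 (zero_le_one' ℝ))] using htop x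

/-- The depth of a wave is bounded away from zero. -/
theorem IsWave.exists_le_profile (h : IsWave ω γ r ψ η) (hω : ContinuousOn ω (Icc 0 1)) :
    ∃ c > 0, ∀ x, c ≤ η x := by
  obtain ⟨C, hC⟩ := isCompact_Icc.exists_bound_of_continuousOn (continuousOn_primitive hω)
  have hr : 0 < r := (h.depth_pos 0).trans_le (h.profile_le 0)
  -- Case `σ = -1`, `δ = 1`. The constant makes `q ≥ 2r + 1` on `[0,1]`, whereas Bernoulli's
  -- equation gives `ψ_y² < 2r` on the surface, so the derivative alternative holds everywhere.
  set q : ℝ → ℝ := fun p => (2 * r + 3 + 2 * C) - 2 * primitive ω p + 2 * (-1 * 1) * p with hq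
  have hqr : ∀ p ∈ Icc (0 : ℝ) 1, 2 * r < q p := by
    intro p hp
    have h1 := (abs_le.1 (hC p hp)).2
    simp only [hq]
    linarith [hp.2]
  have hpos : ∀ p ∈ Icc (0 : ℝ) 1, 0 < q p := fun p hp => by linarith [hqr p hp]
  have hqc : ContinuousOn q (Icc 0 1) := by
    have := continuousOn_primitive hω
    fun_prop
  have hcmp := h.comparison_height hω (B := 0) (Or.inr rfl) one_pos hq hpos le_rfl fun x => by
    right
    have h1 : (1 : ℝ) ∈ Icc (0 : ℝ) 1 := by simp
    have hb := h.bernoulli x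
    have hs := Real.sqrt_pos.2 (hpos 1 h1)
    have h2 : partialY η ψ (x, η x) < √(q 1) := by
      apply Real.lt_sqrt_of_sq_lt
      nlinarith [sq_nonneg (partialX η ψ (x, η x)), h.depth_pos x, hqr 1 h1]
    have h3 : 1 / √(q 1) * partialY η ψ (x, η x) < 1 := by
      rwa [one_div_mul_eq_div, div_lt_one hs]
    linarith
  refine ⟨height q 1, ?_, fun x => ?_⟩
  · rw [← height_zero q]
    exact strictMono_height hqc hpos one_pos
  · have := hcmp (x, η x) ⟨(h.depth_pos x).le, le_rfl⟩
    rw [h.top] at this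
    simp only at this
    linarith

/-- Comparison of a wave with a laminar profile that lies on the right side of the surface. -/
theorem IsWave.comparison_laminar (h : IsWave ω γ r ψ η) (hω : ContinuousOn ω (Icc 0 1))
    {σ E : ℝ} {q : ℝ → ℝ} (hσ : σ = 1 ∨ σ = -1) (hq : q = fun p => E - 2 * primitive ω p)
    (hpos : ∀ p ∈ Icc (0 : ℝ) 1, 0 < q p) (htop : ∀ x, σ * (η x - height q 1) ≤ 0) :
    ∀ z ∈ closedFluid η, σ * (z.2 - height q (ψ z)) ≤ 0 := by
  have hqc : ContinuousOn q (Icc 0 1) := by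
    rw [hq]
    have := continuousOn_primitive hω
    fun_prop
  obtain ⟨p₀, hp₀, hmin⟩ := isCompact_Icc.exists_isMinOn (nonempty_Icc.2 zero_le_one) hqc
  -- Half the minimum of `q` still bounds the perturbed `q'` from below when `2δ ≤ m`.
  set m := q p₀ / 2 with hm
  have hm0 : 0 < m := half_pos (hpos _ hp₀)
  have hσ1 : |σ| = 1 := by rcases hσ with rfl | rfl <;> simp
  intro z hz
  -- The heights of `q` and `q'` differ by at most `2δ/(m√m)`. This is paid twice: on the surface,
  -- as the allowance `B`, and at `z`.
  have key : ∀ δ, 0 < δ → 2 * δ ≤ m → σ * (z.2 - height q (ψ z)) ≤ 2 * (2 * δ / (m * √m)) := by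
    intro δ hδ hδm
    set q' : ℝ → ℝ := fun p => E - 2 * primitive ω p + 2 * (σ * δ) * p with hq'
    have hqc' : ContinuousOn q' (Icc 0 1) := by
      have := continuousOn_primitive hω
      fun_prop
    have hdiff : ∀ p ∈ Icc (0 : ℝ) 1, |q p - q' p| ≤ 2 * δ := by
      intro p hp
      have : q p - q' p = -(σ * (2 * δ * p)) := by simp only [hq, hq']; ring
      rw [this, abs_neg, abs_mul, hσ1, one_mul, abs_of_nonneg (by have := hp.1; positivity)]
      exact mul_le_of_le_one_right (by positivity) hp.2
    have hmq : ∀ p ∈ Icc (0 : ℝ) 1, m ≤ q p := fun p hp => by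
      have : q p₀ ≤ q p := hmin hp
      linarith
    have hmq' : ∀ p ∈ Icc (0 : ℝ) 1, m ≤ q' p := fun p hp => by
      have h1 : q p₀ ≤ q p := hmin hp
      have h2 := (abs_le.1 (hdiff p hp)).2
      linarith
    have hH := fun p hp => abs_height_sub_le hm0 hqc hqc' hmq hmq' hdiff (p := p) hp
    have hs := Real.sqrt_pos.2 hm0
    have hσH : ∀ p ∈ Icc (0 : ℝ) 1, |σ * (height q p - height q' p)| ≤ 2 * δ / (m * √m) := by
      intro p hp
      rw [abs_mul, hσ1, one_mul]
      exact hH p hp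
    have h1 := h.comparison_height hω hσ hδ hq' (fun p hp => hm0.trans_le (hmq' p hp))
      (B := 2 * δ / (m * √m)) (by positivity) (fun x => Or.inl (by
        have h1 := htop x
        have h2 := (abs_le.1 (hσH 1 (by simp))).2
        linarith)) z hz
    have h2 := (abs_le.1 (hσH _ (h.mem_Icc hz))).1
    linarith
  have ht : Tendsto (fun δ : ℝ => 2 * (2 * δ / (m * √m))) (𝓝[>] 0) (𝓝 0) := by
    have : Continuous fun δ : ℝ => 2 * (2 * δ / (m * √m)) := by fun_prop
    have h0 := this.tendsto 0
    simp only [mul_zero, zero_div] at h0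
    exact h0.mono_left nhdsWithin_le_nhds
  refine ge_of_tendsto ht ?_
  filter_upwards [Ioc_mem_nhdsGT (half_pos hm0)] with δ hδ
  exact key δ hδ.1 (by linarith [hδ.2])

/-- Derivative at the bottom of the comparison with a laminar profile. -/
theorem IsWave.comparison_bottom (h : IsWave ω γ r ψ η) (hω : ContinuousOn ω (Icc 0 1))
    {σ E : ℝ} {q : ℝ → ℝ} (hσ : σ = 1 ∨ σ = -1) (hq : q = fun p => E - 2 * primitive ω p)
    (hpos : ∀ p ∈ Icc (0 : ℝ) 1, 0 < q p) (htop : ∀ x, σ * (η x - height q 1) ≤ 0) (x : ℝ) :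
    σ * (√(q 0) - partialY η ψ (x, 0)) ≤ 0 := by
  have hqc : ContinuousOn q (Icc 0 1) := by
    rw [hq]
    have := continuousOn_primitive hω
    fun_prop
  have hcmp := h.comparison_laminar hω hσ hq hpos htop
  have h0 : (0 : ℝ) ∈ Icc (0 : ℝ) 1 := by simp
  have hd := h.hasDerivWithinAt_vertical (left_mem_Icc.2 (h.depth_pos x).le)
  have h1 := (hasDerivAt_height hqc hpos (ψ (x, 0))).comp_hasDerivWithinAt (0 : ℝ) hd
  rw [h.bottom, clamp_of_mem h0] at h1
  have h2 := (((hasDerivWithinAt_id _ _).sub h1).const_mul σ).mono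
    (Ioo_subset_Icc_self (a := (0 : ℝ)) (b := η x))
  rw [hasDerivWithinAt_iff_tendsto_slope' (by simp)] at h2
  have : (𝓝[Ioo 0 (η x)] (0 : ℝ)).NeBot := by
    rw [nhdsWithin_Ioo_eq_nhdsGT (h.depth_pos x)]; infer_instance
  -- The compared function vanishes at the bottom and is nonpositive above it, so its difference
  -- quotients are nonpositive.
  have h3 : σ * (1 - 1 / √(q 0) * partialY η ψ (x, 0)) ≤ 0 := by
    refine le_of_tendsto h2 ?_
    filter_upwards [self_mem_nhdsWithin] with t ht
    rw [slope_def_field]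
    refine div_nonpos_of_nonpos_of_nonneg ?_ (by linarith [ht.1])
    have := hcmp (x, t) ⟨ht.1.le, ht.2.le⟩
    simpa [h.bottom, height_zero] using this
  have hs := Real.sqrt_pos.2 (hpos 0 h0)
  have h4 : σ * (√(q 0) - partialY η ψ (x, 0)) =
      √(q 0) * (σ * (1 - 1 / √(q 0) * partialY η ψ (x, 0))) := by field_simp
  rw [h4]
  exact mul_nonpos_of_nonneg_of_nonpos hs.le h3

end Wave

/-! ### Stream solutions: rigidity and existence. -/

section Stream

variable {ω : ℝ → ℝ} {d : ℝ} {U : ℝ → ℝ}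

lemma IsStream.hasDerivWithinAt (h : IsStream ω d U) {y : ℝ} (hy : y ∈ Icc 0 d) :
    HasDerivWithinAt U (derivWithin U (Icc 0 d) y) (Icc 0 d) y :=
  ((h.regular.differentiableOn (by simp)) y hy).hasDerivWithinAt

lemma IsStream.strictMonoOn (h : IsStream ω d U) : StrictMonoOn U (Icc 0 d) := by
  apply strictMonoOn_of_deriv_pos (convex_Icc _ _) h.regular.continuousOn
  intro y hy
  rw [interior_Icc] at hy
  have hy' := Ioo_subset_Icc_self hy
  rw [((h.hasDerivWithinAt hy').hasDerivAt (Icc_mem_nhds hy.1 hy.2)).deriv]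
  exact h.unidirectional y hy'

lemma IsStream.mem_Icc (h : IsStream ω d U) {y : ℝ} (hy : y ∈ Icc 0 d) : U y ∈ Icc 0 1 := by
  have h0 := h.strictMonoOn.monotoneOn (left_mem_Icc.2 h.depth_pos.le) hy hy.1
  have h1 := h.strictMonoOn.monotoneOn hy (right_mem_Icc.2 h.depth_pos.le) hy.2
  rw [h.bottom] at h0
  rw [h.top] at h1
  exact ⟨h0, h1⟩

lemma IsStream.mem_Ioo (h : IsStream ω d U) {y : ℝ} (hy : y ∈ Ioo 0 d) : U y ∈ Ioo 0 1 := by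
  have hy' := Ioo_subset_Icc_self hy
  have h0 := h.strictMonoOn (left_mem_Icc.2 h.depth_pos.le) hy' hy.1
  have h1 := h.strictMonoOn hy' (right_mem_Icc.2 h.depth_pos.le) hy.2
  rw [h.bottom] at h0
  rw [h.top] at h1
  exact ⟨h0, h1⟩

/-- A continuous function on `[0, d]` with vanishing derivative inside is constant. -/
lemma eq_of_hasDerivAt_zero {f : ℝ → ℝ} (hf : ContinuousOn f (Icc 0 d))
    (hd : ∀ y ∈ Ioo 0 d, HasDerivAt f 0 y) {y : ℝ} (hy : y ∈ Icc 0 d) : f y = f 0 := by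
  rcases hy.1.eq_or_lt with h | h
  · rw [h]
  · obtain ⟨c, -, hc⟩ := exists_hasDerivAt_eq_slope f (fun _ => 0) h
      (hf.mono (Icc_subset_Icc_right hy.2)) fun x hx => hd x ⟨hx.1, hx.2.trans_le hy.2⟩
    rw [eq_comm, div_eq_zero_iff] at hc
    rcases hc with hc | hc <;> linarith

/-- First integral of the stream equation. -/
lemma IsStream.energy_eq (h : IsStream ω d U) (hω : ContinuousOn ω (Icc 0 1)) {y : ℝ}
    (hy : y ∈ Icc 0 d) :
    derivWithin U (Icc 0 d) y ^ 2 + 2 * primitive ω (U y) = derivWithin U (Icc 0 d) 0 ^ 2 := by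
  set V := derivWithin U (Icc 0 d) with hV
  have hVc : ContinuousOn V (Icc 0 d) :=
    h.regular.continuousOn_derivWithin (uniqueDiffOn_Icc h.depth_pos) (by norm_num)
  have key := eq_of_hasDerivAt_zero (f := fun y => V y ^ 2 + 2 * primitive ω (U y)) (d := d)
    ((hVc.pow 2).add (continuousOn_const.mul ((continuousOn_primitive hω).comp
      h.regular.continuousOn fun y hy => h.mem_Icc hy))) (fun y hy => by
      have hn := Icc_mem_nhds hy.1 hy.2
      have hU := hasDerivAt_deriv_of_contDiffAt (h.regular.contDiffAt hn)
      have hVU : V =ᶠ[𝓝 y] deriv U := by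
        filter_upwards [Ioo_mem_nhds hy.1 hy.2] with t ht
        exact derivWithin_of_mem_nhds (Icc_mem_nhds ht.1 ht.2)
      have hV' := hU.2.congr_of_eventuallyEq hVU
      have hU' := hU.1.self_of_nhds
      rw [← hVU.eq_of_nhds] at hU'
      have hΩ := (hasDerivAt_primitive hω (h.mem_Ioo hy)).comp y hU'
      have hsum := (hV'.pow 2).add (hΩ.const_mul 2)
      have hz : (2 : ℕ) * V y ^ (2 - 1) * iteratedDeriv 2 U y + 2 * (ω (U y) * V y) = 0 := by
        have := h.ode y hy
        push_cast
        rw [pow_one]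
        linear_combination 2 * V y * this
      rw [hz] at hsum
      exact hsum) hy
  simpa [h.bottom, primitive_zero] using key

/-- A stream solution is determined by its bottom velocity. -/
theorem IsStream.exists_energy (h : IsStream ω d U) (hω : ContinuousOn ω (Icc 0 1)) :
    ∃ E, (∀ p ∈ Icc (0 : ℝ) 1, 0 < E - 2 * primitive ω p) ∧
      height (fun p => E - 2 * primitive ω p) 1 = d ∧
      derivWithin U (Icc 0 d) 0 = √(E - 2 * primitive ω 0) := by
  set V := derivWithin U (Icc 0 d) with hV
  have h0 := left_mem_Icc.2 h.depth_pos.le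
  have hq : ∀ y ∈ Icc 0 d, V 0 ^ 2 - 2 * primitive ω (U y) = V y ^ 2 := fun y hy => by
    linarith [h.energy_eq hω hy]
  have hpos : ∀ p ∈ Icc (0 : ℝ) 1, 0 < V 0 ^ 2 - 2 * primitive ω p := by
    intro p hp
    obtain ⟨y, hy, rfl⟩ := intermediate_value_Icc h.depth_pos.le h.regular.continuousOn
      (by rwa [h.bottom, h.top])
    rw [hq y hy]
    exact pow_pos (h.unidirectional y hy) 2
  have hqc : ContinuousOn (fun p => V 0 ^ 2 - 2 * primitive ω p) (Icc 0 1) := by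
    have := continuousOn_primitive hω
    fun_prop
  refine ⟨V 0 ^ 2, hpos, ?_, ?_⟩
  · set H := height (fun p => V 0 ^ 2 - 2 * primitive ω p) with hH
    -- By the energy identity `U' = √(q(U))`, so `H` inverts `U`; evaluating at `y = d` gives `H 1 =
    -- d`.
    have hd : ∀ y ∈ Icc 0 d, HasDerivWithinAt (fun y => H (U y) - y) 0 (Icc 0 d) y := by
      intro y hy
      have h1 := ((hasDerivAt_height hqc hpos (U y)).comp_hasDerivWithinAt y
        (h.hasDerivWithinAt hy)).sub (hasDerivWithinAt_id y _)
      have hVy : 0 < V y := h.unidirectional y hy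
      rw [clamp_of_mem (h.mem_Icc hy), hq y hy, Real.sqrt_sq hVy.le,
        one_div_mul_cancel hVy.ne', sub_self] at h1
      exact h1
    have := eq_of_hasDerivAt_zero (fun y hy => (hd y hy).continuousWithinAt)
      (fun y hy => (hd y (Ioo_subset_Icc_self hy)).hasDerivAt (Icc_mem_nhds hy.1 hy.2))
      (right_mem_Icc.2 h.depth_pos.le)
    rw [h.top, h.bottom, hH, height_zero] at this
    linarith
  · rw [primitive_zero, mul_zero, sub_zero, Real.sqrt_sq (h.unidirectional 0 h0).le]

/-- The laminar flow with squared velocity `q = E - 2 Ω`, obtained by inverting the height. -/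
theorem exists_isStream_height (hω : ContinuousOn ω (Icc 0 1)) {E : ℝ} {q : ℝ → ℝ}
    (hq : q = fun p => E - 2 * primitive ω p) (hpos : ∀ p ∈ Icc (0 : ℝ) 1, 0 < q p) :
    ∃ U, IsStream ω (height q 1) U := by
  have hqd : ∀ p ∈ Icc (0 : ℝ) 1, HasDerivWithinAt q (-(2 * ω p)) (Icc 0 1) p := by
    intro p hp
    rw [hq]
    exact ((hasDerivWithinAt_primitive hω hp).const_mul 2).const_sub E
  have hqc : ContinuousOn q (Icc 0 1) := fun p hp => (hqd p hp).continuousWithinAt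
  have hmono := strictMono_height hqc hpos
  have hd0 : 0 < height q 1 := by
    rw [← height_zero q]
    exact hmono one_pos
  set d := height q 1 with hd
  have hcont : Continuous (height q) :=
    continuous_iff_continuousAt.2 fun p => (hasDerivAt_height hqc hpos p).continuousAt
  -- A uniform positive lower bound on the slope makes the extended height map `ℝ` onto `ℝ`, so its
  -- inverse is globally defined.
  obtain ⟨m, hm0, hm⟩ : ∃ m > 0, ∀ p, m ≤ 1 / √(q (clamp p)) := by
    obtain ⟨p₀, hp₀, hmax⟩ := isCompact_Icc.exists_isMaxOn (nonempty_Icc.2 zero_le_one) hqc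
    have hs := Real.sqrt_pos.2 (hpos _ hp₀)
    refine ⟨1 / √(q p₀), by positivity, fun p => ?_⟩
    exact one_div_le_one_div_of_le (Real.sqrt_pos.2 (hpos _ (clamp_mem p)))
      (Real.sqrt_le_sqrt (hmax (clamp_mem p)))
  have hgrow : Monotone fun p => height q p - m * p := by
    have hd : ∀ p, HasDerivAt (fun p => height q p - m * p) (1 / √(q (clamp p)) - m * 1) p :=
      fun p => (hasDerivAt_height hqc hpos p).sub ((hasDerivAt_id p).const_mul m)
    apply monotone_of_deriv_nonneg fun p => (hd p).differentiableAt
    intro p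
    rw [(hd p).deriv]
    linarith [hm p]
  have hsurj : Function.Surjective (height q) := by
    apply hcont.surjective
    · refine tendsto_atTop_mono' atTop ?_ (tendsto_id.const_mul_atTop hm0)
      filter_upwards [eventually_ge_atTop 0] with p hp
      have := hgrow hp
      simp only [height_zero, mul_zero, sub_zero] at this
      simp only [id]
      linarith
    · refine tendsto_atBot_mono' atBot ?_ (tendsto_id.const_mul_atBot hm0)
      filter_upwards [eventually_le_atBot 0] with p hp
      have := hgrow hp
      simp only [height_zero, mul_zero, sub_zero] at this
      simp only [id]
      linarith
  set e := hmono.orderIsoOfSurjective _ hsurj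
  have hHU : ∀ y, height q (e.symm y) = y := fun y => e.apply_symm_apply y
  have hUH : ∀ p, e.symm (height q p) = p := fun p => e.symm_apply_apply p
  have hU0 : e.symm 0 = 0 := by
    have := hUH 0
    rwa [height_zero] at this
  have hU1 : e.symm d = 1 := hUH 1
  have hUd : ∀ y, HasDerivAt e.symm (√(q (clamp (e.symm y)))) y := by
    intro y
    have hs := Real.sqrt_pos.2 (hpos _ (clamp_mem (e.symm y)))
    have := HasDerivAt.of_local_left_inverse (f := height q) (g := e.symm) (a := y)
      e.symm.continuous.continuousAt (hasDerivAt_height hqc hpos _) (by positivity)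
      (Eventually.of_forall hHU)
    rwa [one_div, inv_inv] at this
  have hUm : ∀ y ∈ Icc 0 d, e.symm y ∈ Icc (0 : ℝ) 1 := by
    intro y hy
    rw [← hU0, ← hU1]
    exact ⟨e.symm.monotone hy.1, e.symm.monotone hy.2⟩
  have huniq := uniqueDiffOn_Icc hd0
  have hUw : ∀ y ∈ Icc 0 d, derivWithin e.symm (Icc 0 d) y = √(q (e.symm y)) := by
    intro y hy
    rw [(hUd y).hasDerivWithinAt.derivWithin (huniq y hy), clamp_of_mem (hUm y hy)]
  have hVd : ∀ y ∈ Icc 0 d,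
      HasDerivWithinAt (fun y => √(q (e.symm y))) (-ω (e.symm y)) (Icc 0 d) y := by
    intro y hy
    have hp := hpos _ (hUm y hy)
    have hs := Real.sqrt_pos.2 hp
    have h1 := ((hqd _ (hUm y hy)).comp y (hUd y).hasDerivWithinAt hUm).sqrt hp.ne'
    rw [clamp_of_mem (hUm y hy)] at h1
    have h2 : -(2 * ω (e.symm y)) * √(q (e.symm y)) / (2 * √(q (e.symm y))) =
        -ω (e.symm y) := by field_simp
    simp only [Function.comp_apply] at h1
    rw [h2] at h1
    exact h1
  refine ⟨e.symm, hd0, ?_, ?_, hU0, hU1, ?_⟩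
  -- Regularity is gained one derivative at a time: `U' = √(q(U))`, and then `U'' = -ω(U)` is
  -- continuous.
  · have h1 : ContDiffOn ℝ (1 + 1) e.symm (Icc 0 d) := by
      rw [contDiffOn_succ_iff_derivWithin huniq]
      refine ⟨fun y _ => (hUd y).differentiableAt.differentiableWithinAt, by simp, ?_⟩
      have h2 : ContDiffOn ℝ (0 + 1) (fun y => √(q (e.symm y))) (Icc 0 d) := by
        rw [contDiffOn_succ_iff_derivWithin huniq]
        refine ⟨fun y hy => (hVd y hy).differentiableWithinAt, by simp, contDiffOn_zero.2 ?_⟩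
        refine ContinuousOn.congr (f := fun y => -ω (e.symm y)) ?_
          fun y hy => (hVd y hy).derivWithin (huniq y hy)
        exact (hω.comp e.symm.continuous.continuousOn hUm).neg
      rw [zero_add] at h2
      exact h2.congr hUw
    rwa [one_add_one_eq_two] at h1
  · intro y hy
    have h1 : deriv e.symm =ᶠ[𝓝 y] fun y => √(q (e.symm y)) := by
      filter_upwards [Ioo_mem_nhds hy.1 hy.2] with t ht
      rw [(hUd t).deriv, clamp_of_mem (hUm t (Ioo_subset_Icc_self ht))]
    rw [iteratedDeriv_succ, iteratedDeriv_one, h1.deriv_eq,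
      ((hVd y (Ioo_subset_Icc_self hy)).hasDerivAt (Icc_mem_nhds hy.1 hy.2)).deriv]
    ring
  · intro y hy
    rw [hUw y hy]
    exact Real.sqrt_pos.2 (hpos _ (hUm y hy))

/-- Every depth below `d₀` is attained by a laminar flow. -/
theorem exists_height_eq (hω : ContinuousOn ω (Icc 0 1)) (hd0 : 0 < d)
    (hd : ENNReal.ofReal d < maxDepth ω) :
    ∃ E, (∀ p ∈ Icc (0 : ℝ) 1, 0 < E - 2 * primitive ω p) ∧
      height (fun p => E - 2 * primitive ω p) 1 = d := by
  have hΩ := continuousOn_primitive hω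
  have hbdd : BddAbove ((fun p => 2 * primitive ω p) '' Icc 0 1) :=
    (isCompact_Icc.image_of_continuousOn (by fun_prop)).bddAbove
  set E₀ := sSup ((fun p => 2 * primitive ω p) '' Icc 0 1) with hE₀
  have hle : ∀ p ∈ Icc (0 : ℝ) 1, 2 * primitive ω p ≤ E₀ := fun p hp =>
    le_csSup hbdd (mem_image_of_mem _ hp)
  have hE₀0 : 0 ≤ E₀ := by simpa [primitive_zero] using hle 0 (by simp)
  have hs0 : sZero ω ^ 2 = E₀ := Real.sq_sqrt hE₀0
  have hqc : ∀ E, ContinuousOn (fun p => E - 2 * primitive ω p) (Icc 0 1) := fun E => by fun_prop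
  have hpos : ∀ E, E₀ < E → ∀ p ∈ Icc (0 : ℝ) 1, 0 < E - 2 * primitive ω p :=
    fun E hE p hp => by linarith [hle p hp]
  set T : ℝ → ℝ := fun E => height (fun p => E - 2 * primitive ω p) 1 with hT
  obtain ⟨a, ha, hda⟩ : ∃ a, E₀ < a ∧ d ≤ T a := by
    -- If all depths `T a` with `a > E₀` were below `d`, Fatou's lemma along `E₀ + 1/(n+1)` would
    -- give `d₀ ≤ d`.
    by_contra! hcon
    let F : ℕ → ℝ → ℝ≥0∞ := fun n p =>
      ENNReal.ofReal (1 / √(E₀ + 1 / ((n : ℝ) + 1) - 2 * primitive ω (clamp p)))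
    have hEn : ∀ n : ℕ, E₀ < E₀ + 1 / ((n : ℝ) + 1) := fun n => by
      have : (0 : ℝ) < 1 / ((n : ℝ) + 1) := by positivity
      linarith
    have hFc : ∀ n : ℕ, Continuous fun p =>
        1 / √(E₀ + 1 / ((n : ℝ) + 1) - 2 * primitive ω (clamp p)) := fun n =>
      continuous_invSqrt_clamp (hqc _) (hpos _ (hEn n))
    have hFi : ∀ n, ∫⁻ p in Icc (0 : ℝ) 1, F n p = ENNReal.ofReal (T (E₀ + 1 / ((n : ℝ) + 1))) := by
      intro n
      rw [hT]
      simp only [height]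
      rw [intervalIntegral.integral_of_le zero_le_one, ← integral_Icc_eq_integral_Ioc]
      rw [ofReal_integral_eq_lintegral_ofReal]
      · exact (hFc n).continuousOn.integrableOn_Icc
      · exact Eventually.of_forall fun p => by positivity
    have hlim : ∫⁻ p in Icc (0 : ℝ) 1, liminf (fun n => F n p) atTop = maxDepth ω := by
      refine setLIntegral_congr_fun measurableSet_Icc fun p hp => ?_
      apply Tendsto.liminf_eq
      have h1 : Tendsto (fun n : ℕ => ENNReal.ofReal
          √(E₀ + 1 / ((n : ℝ) + 1) - 2 * primitive ω p)) atTop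
          (𝓝 (ENNReal.ofReal √(E₀ - 2 * primitive ω p))) := by
        have h2 : Tendsto (fun n : ℕ => E₀ + 1 / ((n : ℝ) + 1) - 2 * primitive ω p) atTop
            (𝓝 (E₀ + 0 - 2 * primitive ω p)) :=
          (tendsto_one_div_add_atTop_nhds_zero_nat.const_add E₀).sub_const _
        rw [add_zero] at h2
        exact (ENNReal.continuous_ofReal.tendsto _).comp
          ((Real.continuous_sqrt.tendsto _).comp h2)
      simp only [hs0]
      refine (tendsto_inv_iff.2 h1).congr fun n => ?_
      simp only [F]
      rw [clamp_of_mem hp, one_div (√_), ENNReal.ofReal_inv_of_pos]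
      exact Real.sqrt_pos.2 (hpos _ (hEn n) p hp)
    have hfatou := lintegral_liminf_le (u := atTop) (μ := volume.restrict (Icc (0 : ℝ) 1)) (f := F)
      fun n => (ENNReal.continuous_ofReal.comp (hFc n)).measurable
    rw [hlim] at hfatou
    refine (hd.trans_le hfatou).not_ge ?_
    refine (liminf_le_liminf (v := fun _ => ENNReal.ofReal d) (Eventually.of_forall fun n => ?_)).trans
      (by simp)
    simp only [hFi]
    exact ENNReal.ofReal_le_ofReal (hcon _ (hEn n)).le
  obtain ⟨b, hb, hdb⟩ : ∃ b, E₀ < b ∧ T b ≤ d := by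
    -- With this energy every streamline moves at speed at least `1/d`, so the total height is at
    -- most `d`.
    have hb : E₀ < E₀ + (1 / d) ^ 2 := by
      have : 0 < (1 / d) ^ 2 := by positivity
      linarith
    refine ⟨E₀ + (1 / d) ^ 2, hb, ?_⟩
    have := intervalIntegral.norm_integral_le_of_norm_le_const (a := (0 : ℝ)) (b := 1) (C := d)
      (f := fun t => 1 / √(E₀ + (1 / d) ^ 2 - 2 * primitive ω (clamp t))) fun t _ => by
        rw [Real.norm_eq_abs, abs_of_nonneg (by positivity), div_le_comm₀
          (Real.sqrt_pos.2 (hpos _ hb _ (clamp_mem t))) hd0]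
        apply Real.le_sqrt_of_sq_le
        linarith [hle _ (clamp_mem t)]
    simp only [sub_zero, abs_one, mul_one] at this
    exact (le_abs_self _).trans this
  have hTc : ContinuousOn T (uIcc a b) := by
    -- Between `a` and `b` the squared velocity stays above `m`, so `T` is Lipschitz there.
    set m := min a b - E₀ with hm
    have hm0 : 0 < m := sub_pos.2 (lt_min ha hb)
    have hmq : ∀ E ∈ uIcc a b, ∀ p ∈ Icc (0 : ℝ) 1, m ≤ E - 2 * primitive ω p := by
      intro E hE p hp
      have h1 := hle p hp
      have h2 : min a b ≤ E := hE.1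
      linarith
    have hs := Real.sqrt_pos.2 hm0
    refine (LipschitzOnWith.of_dist_le_mul (K := Real.toNNReal (1 / (m * √m)))
      fun x hx y hy => ?_).continuousOn
    rw [Real.coe_toNNReal _ (by positivity), Real.dist_eq, Real.dist_eq, one_div_mul_eq_div]
    exact abs_height_sub_le hm0 (hqc x) (hqc y) (hmq x hx) (hmq y hy)
      (fun p _ => by rw [sub_sub_sub_cancel_right]) (by simp)
  obtain ⟨E, hE, hEd⟩ := intermediate_value_uIcc hTc (mem_uIcc_of_ge hdb hda)
  exact ⟨E, hpos E ((lt_min ha hb).trans_le hE.1), hEd⟩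

theorem exists_isStream (hω : ContinuousOn ω (Icc 0 1)) (hd0 : 0 < d)
    (hd : ENNReal.ofReal d < maxDepth ω) : ∃ U, IsStream ω d U := by
  obtain ⟨E, hE, rfl⟩ := exists_height_eq hω hd0 hd
  exact exists_isStream_height hω rfl hE

end Stream

end WaterWave


/-! ### The bounds on the bottom velocity. -/

theorem proposition3p1 (γ : ℝ≥0) (hγ0 : 0 < γ) (hγ1 : γ < 1)
    (ω : ℝ → ℝ) (hω : WaterWave.HolderClass 1 γ ω (Icc 0 1))
    (r : ℝ) (hr : WaterWave.criticalBernoulli ω < r)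
    (hr' : ENNReal.ofReal r < WaterWave.maxDepth ω)
    (ψ : ℝ × ℝ → ℝ) (η : ℝ → ℝ) (hψ : WaterWave.IsWave ω γ r ψ η) :
    (∃ U, WaterWave.IsStream ω (⨆ x, η x) U) ∧
    (∃ U, WaterWave.IsStream ω (⨅ x, η x) U) ∧
    ∀ Umax Umin : ℝ → ℝ,
      WaterWave.IsStream ω (⨆ x, η x) Umax → WaterWave.IsStream ω (⨅ x, η x) Umin →
      ∀ x : ℝ,
        derivWithin Umax (Icc 0 (⨆ x, η x)) 0 ≤ WaterWave.partialY η ψ (x, 0) ∧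
        WaterWave.partialY η ψ (x, 0) ≤ derivWithin Umin (Icc 0 (⨅ x, η x)) 0 := by
  have hωc : ContinuousOn ω (Icc 0 1) := hω.1.continuousOn
  have hsup : ∀ x, η x ≤ ⨆ x, η x := fun x => le_ciSup hψ.bddAbove_profile x
  have hinf : ∀ x, ⨅ x, η x ≤ η x := fun x => ciInf_le hψ.bddBelow_profile x
  have hsupr : ⨆ x, η x ≤ r := ciSup_le hψ.profile_le
  -- Pointwise positivity of `η` does not suffice, as the infimum need not be attained.
  obtain ⟨c, hc, hcη⟩ := hψ.exists_le_profile hωc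
  have hinf0 : 0 < ⨅ x, η x := hc.trans_le (le_ciInf hcη)
  refine ⟨?_, ?_, fun Umax Umin hmax hmin x => ⟨?_, ?_⟩⟩
  · exact WaterWave.exists_isStream hωc ((hψ.depth_pos 0).trans_le (hsup 0))
      ((ENNReal.ofReal_le_ofReal hsupr).trans_lt hr')
  · exact WaterWave.exists_isStream hωc hinf0
      ((ENNReal.ofReal_le_ofReal ((hinf 0).trans ((hsup 0).trans hsupr))).trans_lt hr')
  -- The given solution supplies its own energy `E`, so no uniqueness of the flow of given depth is
  -- needed.
  · obtain ⟨E, hpos, hE, hU⟩ := hmax.exists_energy hωc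
    have := hψ.comparison_bottom hωc (Or.inl rfl) rfl hpos
      (fun x => by rw [hE, one_mul]; exact sub_nonpos.2 (hsup x)) x
    rw [hU]
    linarith
  · obtain ⟨E, hpos, hE, hU⟩ := hmin.exists_energy hωc
    have := hψ.comparison_bottom hωc (Or.inr rfl) rfl hpos
      (fun x => by rw [hE]; linarith [hinf x]) x
    rw [hU]
    linarith
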